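/- Write $c_0=(36\pi)^{1/3}$ and $\eta=(a,v)\in(0,\infty)^2$. For $I=(0,\infty)$ or $I=(0,\infty)^2$ let $\mathscr M_+(I)$ be the space of non-negative Radon measures on $I$ with the weak-$*$ topology, i.e. the coarsest topology for which $m\mapsto\int\varphi\,dm$ is continuous for every $\varphi\in C_c(I)$, and let $\mathscr M_+^I((0,\infty)^2)$ be the set of $h\in\mathscr M_+((0,\infty)^2)$ with $h(\{a<c_0v^{2/3}\})=0$. **Kernels.** Let $\alpha>0$, $\beta\in(0,1)$ with $\beta-\alpha\in(0,1)$, and let $K:(0,\infty)^4\to[0,\infty)$ be continuous with $K(\eta,\eta')=K(\eta',\eta)$ and, for some constants $K_1,K_0>0$, $$K_1\big(v^{-\alpha}v'^{\beta}+v'^{-\alpha}v^{\beta}\big)\le K(a,v,a',v')\le K_0\big(v^{-\alpha}v'^{\beta}+v'^{-\alpha}v^{\beta}\big)\quad\text{on }(0,\infty)^4 .$$ Let $\mu,\sigma\in\mathbb R$ and let $r\in C^1((0,\infty)^2)$ satisfy, for some constants $R_0,R_1,B>0$, $R_0a^\mu v^\sigma\le r(a,v)\le R_1a^\mu v^\sigma$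 on $(0,\infty)^2$ and, whenever $a\ge c_0v^{2/3}$, $\partial_ar\le Ba^{-1}r$ together with $\partial_ar-\mu a^{-1}r\ge0$ if $\mu>0$, and with $(a-c_0v^{2/3})\,\partial_ar+r\ge0$ if $\mu\le0$. **Solutions.** Let $f_{\rm in}\in\mathscr M_+^I((0,\infty)^2)$. For every $\epsilon\in(0,1)$ let $f_\epsilon\in C([0,\infty);\mathscr M_+^I((0,\infty)^2))$ be such that $\sup_{t\in[0,T']}\int(v^{-\alpha}+v^\beta)\,f_\epsilon(d\eta,t)<\infty$ for every $T'>0$, and, for every $t\ge0$ and every $C^1$ function $\varphi(\eta,s)$ with compact support in $(0,\infty)^2\times[0,\infty)$, $$\int\varphi(\eta,t)f_\epsilon(d\eta,t)-\int\varphi(\eta,0)f_{\rm in}(d\eta)-\int_0^t\!\!\int\partial_s\varphi(\eta,s)\,f_\epsilon(d\eta,s)\,ds$$ $$=\int_0^t\langle\mathbb K[f_\epsilon(s)],\varphi(s)\rangle\,ds+\frac1\epsilon\int_0^t\!\!\int r(\eta)(c_0v^{2/3}-a)\,\partial_a\varphi(\eta,s)\,f_\epsilon(d\eta,s)\,ds,$$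 where $\langle\mathbb K[m],\psi\rangle=\frac12\iint K(\eta,\eta')[\psi(\eta+\eta')-\psi(\eta)-\psi(\eta')]\,m(d\eta')\,m(d\eta)$. Let $T>0$. Assume that there is a constant $C(T)$, independent of $\epsilon\in(0,1)$, such that $$\sup_{t\in[0,T]}\int_{(0,\infty)^2}w(a,v)\,f_\epsilon(d\eta,t)\le C(T),\qquad w=\begin{cases}v^{-\mu-3}+v^{\mu+3}+v^{\sigma(\mu+3)}+a^{\mu+3},&\mu>0,\\ v^{-1}+v^2+a,&\mu\le0.\end{cases}$$ Let $\epsilon_n\in(0,1)$ with $\epsilon_n\to0$ and let $\overline f\in C((0,T];\mathscr M_+^I((0,\infty)^2))$ be such that $f_{\epsilon_n}(t)\to\overline f(t)$ in the weak-$*$ topology for every $t\in(0,T]$. **Lemma.** Then $\overline f(a,v,t)=F(v,t)\,\delta(a-c_0v^{2/3})$ in the sense of measures. More precisely, there exists $F\in C((0,T];\mathscr M_+((0,\infty)))$ such that, for every $t\in(0,T]$, $F(\cdot,t)$ is a finite measure, $\overline f(\cdot,t)$ is the image of $F(\cdot,t)$ under $v\mapsto(c_0v^{2/3},v)$, and $$\int_{(0,\infty)^2}\varphi(a,v)\,\overline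 f(d\eta,t)=\int_{(0,\infty)}\varphi(c_0v^{2/3},v)\,F(dv,t)\qquad\text{for every }\varphi\in C_0((0,\infty)^2),$$ both integrals being absolutely convergent. Moreover $t\mapsto\int\varphi\,dF(\cdot,t)$ is continuous on $(0,T]$ also for every $\varphi\in C_0((0,\infty))$. -/

import Mathlib

open MeasureTheory Set Filter Topology
open scoped CompactlySupported ZeroAtInfty

namespace FastFusion

/-- The half-line `(0, ∞)`. -/
abbrev PosReal : Type := Set.Ioi (0 : ℝ)

/-- The open quadrant `(0, ∞)²`. A point `η = (a, v)` consists of an area `a` and a volume `v`. -/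
abbrev Quadrant : Type := PosReal × PosReal

/-- The space `𝓜₊(X)` of non-negative Radon measures on `X`. It is used only for `X = (0, ∞)` and
`X = (0, ∞)²`, where a Borel measure is Radon as soon as it is finite on compact sets. -/
def RadonMeasure (X : Type*) [TopologicalSpace X] [MeasurableSpace X] : Type _ :=
  {m : Measure X // IsFiniteMeasureOnCompacts m}

/-- The weak-* topology on `𝓜₊(X)`: the coarsest topology for which `m ↦ ∫ φ dm` is continuous
for every continuous function `φ` with compact support. -/
noncomputable instance (X : Type*) [TopologicalSpace X] [MeasurableSpace X] :
    TopologicalSpace (RadonMeasure X) :=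
  TopologicalSpace.induced (fun (m : RadonMeasure X) (φ : C_c(X, ℝ)) => ∫ x, φ x ∂m.1)
    inferInstance

/-- The isoperimetric constant `c₀ = (36π)^{1/3}`. -/
noncomputable def c0 : ℝ := (36 * Real.pi) ^ (1 / 3 : ℝ)

/-- The area `c₀ v^{2/3}` of a ball of volume `v`. -/
noncomputable def sphereArea (v : ℝ) : ℝ := c0 * v ^ (2 / 3 : ℝ)

theorem sphereArea_pos {v : ℝ} (hv : 0 < v) : 0 < sphereArea v := by
  unfold sphereArea c0
  positivity

/-- The point `(c₀ v^{2/3}, v)` of the isoperimetric line. -/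
noncomputable def isoPoint (v : PosReal) : Quadrant :=
  (⟨sphereArea v, sphereArea_pos v.2⟩, v)

/-- The space `𝓜₊ᴵ((0, ∞)²)` of Radon measures that vanish on `{a < c₀ v^{2/3}}`. -/
def isoperimetricMeasures : Set (RadonMeasure Quadrant) :=
  {h | h.1 {η : Quadrant | (η.1 : ℝ) < sphereArea η.2} = 0}

/-- The conditions on the exponents and on the coagulation kernel `K`. -/
structure IsCoagulationKernel (α β : ℝ) (K : Quadrant → Quadrant → ℝ) : Prop where
  alpha_pos : 0 < α
  beta_mem : β ∈ Ioo (0 : ℝ) 1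
  sub_mem : β - α ∈ Ioo (0 : ℝ) 1
  continuous : Continuous (Function.uncurry K)
  nonneg : ∀ η η', 0 ≤ K η η'
  symm : ∀ η η', K η η' = K η' η
  bounds : ∃ K₁ > 0, ∃ K₀ > 0, ∀ η η' : Quadrant,
    K₁ * ((η.2 : ℝ) ^ (-α) * (η'.2 : ℝ) ^ β + (η'.2 : ℝ) ^ (-α) * (η.2 : ℝ) ^ β) ≤ K η η' ∧
    K η η' ≤ K₀ * ((η.2 : ℝ) ^ (-α) * (η'.2 : ℝ) ^ β + (η'.2 : ℝ) ^ (-α) * (η.2 : ℝ) ^ β)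

/-- The conditions on the fusion kernel `r(a, v)` with exponents `μ, σ`. Only the values of `r` on
`(0, ∞)²` matter. -/
structure IsFusionKernel (μ σ : ℝ) (r : ℝ → ℝ → ℝ) : Prop where
  contDiffOn : ContDiffOn ℝ 1 (Function.uncurry r) (Ioi 0 ×ˢ Ioi 0)
  bounds : ∃ R₀ > 0, ∃ R₁ > 0, ∀ a > 0, ∀ v > 0,
    R₀ * (a ^ μ * v ^ σ) ≤ r a v ∧ r a v ≤ R₁ * (a ^ μ * v ^ σ)
  deriv_upper : ∃ B > 0, ∀ a > 0, ∀ v > 0, sphereArea v ≤ a →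
    deriv (fun x => r x v) a ≤ B * a⁻¹ * r a v
  deriv_lower_of_pos : 0 < μ → ∀ a > 0, ∀ v > 0, sphereArea v ≤ a →
    0 ≤ deriv (fun x => r x v) a - μ * a⁻¹ * r a v
  deriv_lower_of_nonpos : μ ≤ 0 → ∀ a > 0, ∀ v > 0, sphereArea v ≤ a →
    0 ≤ deriv (fun x => r x v) a * (a - sphereArea v) + r a v

/-- Test functions `φ(t, a, v)`: of class `C¹`, with compact support in `t`, `a > 0`, `v > 0`. They
are written as functions on `ℝ × ℝ²`, but only times `t ≥ 0` are used, so the support may touch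
`t = 0`. -/
structure IsTestFunction (φ : ℝ → ℝ → ℝ → ℝ) : Prop where
  contDiff : ContDiff ℝ 1 (fun p : ℝ × ℝ × ℝ => φ p.1 p.2.1 p.2.2)
  compact : HasCompactSupport (fun p : ℝ × ℝ × ℝ => φ p.1 p.2.1 p.2.2)
  support : tsupport (fun p : ℝ × ℝ × ℝ => φ p.1 p.2.1 p.2.2) ⊆ {p | 0 < p.2.1 ∧ 0 < p.2.2}

/-- The weak coagulation operator `⟨𝕂[m], ψ⟩ =
½ ∫∫ K(η, η') (ψ(η + η') - ψ(η) - ψ(η')) m(dη') m(dη)`. -/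
noncomputable def coagulation (K : Quadrant → Quadrant → ℝ) (m : RadonMeasure Quadrant)
    (ψ : ℝ → ℝ → ℝ) : ℝ :=
  (1 / 2) * ∫ η : Quadrant, ∫ η' : Quadrant,
    K η η' * (ψ (η.1 + η'.1) (η.2 + η'.2) - ψ η.1 η.2 - ψ η'.1 η'.2) ∂m.1 ∂m.1

/-- `f` is a solution of the weak version of the time-dependent fusion problem with parameter `Λ`
and initial datum `fin`. -/
structure IsFusionSolution (α β : ℝ) (K : Quadrant → Quadrant → ℝ) (r : ℝ → ℝ → ℝ) (Λ : ℝ)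
    (fin : RadonMeasure Quadrant) (f : ℝ → RadonMeasure Quadrant) : Prop where
  mem : ∀ t ≥ 0, f t ∈ isoperimetricMeasures
  continuousOn : ContinuousOn f (Ici 0)
  moments : ∀ T > 0, ∃ C : ℝ, ∀ t ∈ Icc 0 T,
    ∫⁻ η : Quadrant, ENNReal.ofReal ((η.2 : ℝ) ^ (-α) + (η.2 : ℝ) ^ β) ∂(f t).1
      ≤ ENNReal.ofReal C
  weak : ∀ φ : ℝ → ℝ → ℝ → ℝ, IsTestFunction φ → ∀ t ≥ 0,
    (∫ η : Quadrant, φ t η.1 η.2 ∂(f t).1) - (∫ η : Quadrant, φ 0 η.1 η.2 ∂fin.1)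
        - ∫ s in (0 : ℝ)..t, ∫ η : Quadrant, deriv (fun τ => φ τ η.1 η.2) s ∂(f s).1
      = (∫ s in (0 : ℝ)..t, coagulation K (f s) (φ s))
        + (1 / Λ) * ∫ s in (0 : ℝ)..t, ∫ η : Quadrant,
            r η.1 η.2 * (sphereArea η.2 - η.1) * deriv (fun x => φ s x η.2) η.1 ∂(f s).1

/-- The weight of the uniform moment estimate: `v^{-μ-3} + v^{μ+3} + v^{σ(μ+3)} + a^{μ+3}` if
`μ > 0`, and `v^{-1} + v² + a` if `μ ≤ 0`. -/
noncomputable def momentWeight (μ σ : ℝ) (η : Quadrant) : ℝ :=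
  if 0 < μ then
    (η.2 : ℝ) ^ (-μ - 3) + (η.2 : ℝ) ^ (μ + 3) + (η.2 : ℝ) ^ (σ * (μ + 3)) + (η.1 : ℝ) ^ (μ + 3)
  else (η.2 : ℝ)⁻¹ + (η.2 : ℝ) ^ 2 + (η.1 : ℝ)

end FastFusion

namespace FastFusion

/-! ### The weak-* topology -/

/-! Fusion at rate `1/ε` drives areas down to `c₀ v^{2/3}`, while every other term of the weak
equation is bounded uniformly in `ε`. For a test function `χ(v) g(a)`, constant in time on `[0, T]`,
coagulation is controlled by a product of two moments (`abs_coagulation_le`), so the fusion integral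
is `O(ε)` (`abs_fusion_integral_le`). Since the solutions live on `a ≥ c₀ v^{2/3}`, its integrand `r
(a - c₀ v^{2/3}) χ g'` has a sign as soon as `χ, g' ≥ 0`.

To localize near a point off the line, `g'` should be a bump. Its primitive is constant and nonzero
at large areas, so it has to be cut off at some area `M`. The cutoff costs `O(1/M)` uniformly in
`ε`, because for large `a` the weight dominates `a^{μ+1}`. Fixing `M` first and then letting `ε → 0`
shows that the time integral of the localized flux vanishes in the limit (`exists_localized_flux`).
The limit flux is nonnegative and continuous in time, hence zero at every time
(`eqOn_zero_of_tendsto_integral`), so `fbar` has no mass near any point off the line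
(`ae_eq_sphereArea_of_tendsto`).

The density `F` is then the volume marginal of `fbar`: on the line, `isoPoint` inverts the
projection to `v`. Continuity in time against `C_c` passes to the marginal by cutting off around the
line, and extends to `C₀` through the uniform mass bound inherited from the moments. -/

theorem isInducing_integral (X : Type*) [TopologicalSpace X] [MeasurableSpace X] :
    IsInducing (fun (m : RadonMeasure X) (φ : C_c(X, ℝ)) => ∫ x, φ x ∂m.1) :=
  ⟨rfl⟩

theorem tendsto_radonMeasure_iff {X ι : Type*} [TopologicalSpace X] [MeasurableSpace X]
    {l : Filter ι} {m : ι → RadonMeasure X} {m₀ : RadonMeasure X} :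
    Tendsto m l (𝓝 m₀) ↔
      ∀ φ : C_c(X, ℝ), Tendsto (fun i => ∫ x, φ x ∂(m i).1) l (𝓝 (∫ x, φ x ∂m₀.1)) := by
  rw [(isInducing_integral X).tendsto_nhds_iff, tendsto_pi_nhds]
  rfl

theorem continuousOn_radonMeasure_iff {X ι : Type*} [TopologicalSpace X] [MeasurableSpace X]
    [TopologicalSpace ι] {s : Set ι} {m : ι → RadonMeasure X} :
    ContinuousOn m s ↔ ∀ φ : C_c(X, ℝ), ContinuousOn (fun i => ∫ x, φ x ∂(m i).1) s := by
  rw [(isInducing_integral X).continuousOn_iff, continuousOn_pi]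
  rfl

instance : LocallyCompactSpace PosReal := isOpen_Ioi.locallyCompactSpace

/-- The total mass is lower semicontinuous for the weak-* convergence. -/
theorem measure_univ_le_of_tendsto {X : Type*} [TopologicalSpace X] [MeasurableSpace X]
    [BorelSpace X] [T2Space X] [LocallyCompactSpace X] [SigmaCompactSpace X]
    {m : ℕ → Measure X} {m₀ : Measure X} [IsFiniteMeasureOnCompacts m₀]
    (hm : ∀ φ : C_c(X, ℝ), Tendsto (fun n => ∫ x, φ x ∂m n) atTop (𝓝 (∫ x, φ x ∂m₀)))
    {C : ℝ} (hC : 0 ≤ C) (hbound : ∀ n, m n univ ≤ ENNReal.ofReal C) :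
    m₀ univ ≤ ENNReal.ofReal C := by
  have hfin : ∀ n, IsFiniteMeasure (m n) :=
    fun n => ⟨(hbound n).trans_lt ENNReal.ofReal_lt_top⟩
  have key : ∀ n, m₀ (compactCovering X n) ≤ ENNReal.ofReal C := by
    intro k
    -- The convergence only sees compactly supported functions, so the mass is bounded on each
    -- compact set by a plateau function and then exhausted.
    obtain ⟨g, hg1, -, hgc, hg⟩ := exists_continuous_one_zero_of_isCompact
      (isCompact_compactCovering X k) isClosed_empty (disjoint_empty _)
    have hle : ∀ n, ∫ x, g x ∂m n ≤ C := by
      intro n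
      calc ∫ x, g x ∂m n ≤ ∫ _, (1 : ℝ) ∂m n :=
            integral_mono (g.continuous.integrable_of_hasCompactSupport hgc)
              (integrable_const 1) fun x => (hg x).2
        _ = (m n univ).toReal := by simp [Measure.real]
        _ ≤ C := ENNReal.toReal_le_of_le_ofReal hC (hbound n)
    have hle₀ : ∫ x, g x ∂m₀ ≤ C := le_of_tendsto (hm ⟨g, hgc⟩) (Eventually.of_forall hle)
    have hK := (isCompact_compactCovering X k)
    have h1 : (m₀ (compactCovering X k)).toReal ≤ C := by
      refine le_trans ?_ hle₀
      calc (m₀ (compactCovering X k)).toReal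
          = ∫ x, (compactCovering X k).indicator 1 x ∂m₀ := by
            rw [integral_indicator_one hK.measurableSet]; rfl
        _ ≤ ∫ x, g x ∂m₀ := by
            refine integral_mono ?_ (g.continuous.integrable_of_hasCompactSupport hgc) ?_
            · exact (integrable_indicator_iff hK.measurableSet).2
                (integrableOn_const hK.measure_lt_top.ne)
            · intro x
              by_cases hx : x ∈ compactCovering X k
              · simp [hx, hg1 hx]
              · simp [hx, (hg x).1]
    rwa [ENNReal.le_ofReal_iff_toReal_le hK.measure_lt_top.ne hC]
  have hmono : Monotone (compactCovering X) := fun _ _ h => compactCovering_subset X h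
  rw [← iUnion_compactCovering X, hmono.measure_iUnion]
  exact iSup_le key

/-! ### The moment weight -/

theorem rpow_le_rpow_add_rpow {x p q s : ℝ} (hx : 0 < x) (hpq : p ≤ q) (hqs : q ≤ s) :
    x ^ q ≤ x ^ p + x ^ s := by
  have h1 := Real.rpow_nonneg hx.le p
  have h2 := Real.rpow_nonneg hx.le s
  rcases le_total x 1 with h | h
  · linarith [Real.rpow_le_rpow_of_exponent_ge hx h hpq]
  · linarith [Real.rpow_le_rpow_of_exponent_le h hqs]

/-- Both forms of the weight contain a power of `v` at most `-1` and one at least `2`, and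
intermediate powers are dominated by their sum. The range `[-1, 2]` covers the exponents `0`, `β`
and `-α` that occur later, since `0 < α < β < 1`. -/
theorem rpow_le_momentWeight (μ σ : ℝ) {q : ℝ} (hq : -1 ≤ q) (hq' : q ≤ 2) (η : Quadrant) :
    (η.2 : ℝ) ^ q ≤ momentWeight μ σ η := by
  have hv : 0 < (η.2 : ℝ) := η.2.2
  have ha : 0 < (η.1 : ℝ) := η.1.2
  unfold momentWeight
  split_ifs with h
  · have := rpow_le_rpow_add_rpow (p := -μ - 3) (s := μ + 3) hv (by linarith : _ ≤ q) (by linarith)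
    have := Real.rpow_nonneg hv.le (σ * (μ + 3))
    have := Real.rpow_nonneg ha.le (μ + 3)
    linarith
  · have := rpow_le_rpow_add_rpow hv hq hq'
    rw [Real.rpow_neg_one, Real.rpow_two] at this
    linarith

theorem one_le_momentWeight (μ σ : ℝ) (η : Quadrant) : 1 ≤ momentWeight μ σ η := by
  simpa using rpow_le_momentWeight μ σ (q := 0) (by norm_num) (by norm_num) η

/-- The weight dominates `a^{μ+1}` when `a ≥ 1`, one power more than the growth of `r` in `a`. This
spare power is the gain `1/M` that makes the cutoff at large areas harmless. -/
theorem rpow_area_le_momentWeight (μ σ : ℝ) {M : ℝ} (hM : 1 ≤ M) (η : Quadrant)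
    (h : M ≤ (η.1 : ℝ)) : (η.1 : ℝ) ^ μ ≤ momentWeight μ σ η / M := by
  have hv : 0 < (η.2 : ℝ) := η.2.2
  have ha : 0 < (η.1 : ℝ) := η.1.2
  rw [le_div_iff₀ (by linarith)]
  have ha1 : 1 ≤ (η.1 : ℝ) := hM.trans h
  have h1 : (η.1 : ℝ) ^ μ * M ≤ (η.1 : ℝ) ^ (μ + 1) := by
    rw [Real.rpow_add_one ha.ne']
    gcongr
  refine h1.trans ?_
  unfold momentWeight
  split_ifs with hμ
  · have := Real.rpow_nonneg hv.le (σ * (μ + 3))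
    have := Real.rpow_nonneg hv.le (-μ - 3)
    have := Real.rpow_nonneg hv.le (μ + 3)
    have := Real.rpow_le_rpow_of_exponent_le ha1 (by linarith : μ + 1 ≤ μ + 3)
    linarith
  · have h2 := Real.rpow_le_rpow_of_exponent_le ha1 (by linarith : μ + 1 ≤ 1)
    rw [Real.rpow_one] at h2
    have := inv_pos.2 hv
    have := pow_pos hv 2
    linarith

theorem continuous_momentWeight (μ σ : ℝ) : Continuous (momentWeight μ σ) := by
  have ha : ∀ p : ℝ, Continuous fun η : Quadrant => (η.1 : ℝ) ^ p := fun p =>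
    (continuous_subtype_val.comp continuous_fst).rpow_const fun η => Or.inl (ne_of_gt η.1.2)
  have hv : ∀ p : ℝ, Continuous fun η : Quadrant => (η.2 : ℝ) ^ p := fun p =>
    (continuous_subtype_val.comp continuous_snd).rpow_const fun η => Or.inl (ne_of_gt η.2.2)
  unfold momentWeight
  split_ifs with hμ
  · exact (((hv _).add (hv _)).add (hv _)).add (ha _)
  · have h1 := hv (-1)
    simp only [Real.rpow_neg_one] at h1
    fun_prop

/-- The measures whose `momentWeight` moment is at most `C`. -/
def HasMomentBound (μ σ C : ℝ) (m : Measure Quadrant) : Prop :=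
  ∫⁻ η, ENNReal.ofReal (momentWeight μ σ η) ∂m ≤ ENNReal.ofReal C

namespace HasMomentBound

variable {μ σ C : ℝ} {m : Measure Quadrant}

theorem integrable (h : HasMomentBound μ σ C m) : Integrable (momentWeight μ σ) m := by
  refine ⟨(continuous_momentWeight μ σ).aestronglyMeasurable, ?_⟩
  rw [hasFiniteIntegral_iff_ofReal
    (ae_of_all _ fun η => zero_le_one.trans (one_le_momentWeight μ σ η))]
  exact h.trans_lt ENNReal.ofReal_lt_top

theorem integral_le (h : HasMomentBound μ σ C m) (hC : 0 ≤ C) :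
    ∫ η, momentWeight μ σ η ∂m ≤ C := by
  rw [integral_eq_lintegral_of_nonneg_ae
    (ae_of_all _ fun η => zero_le_one.trans (one_le_momentWeight μ σ η))
    (continuous_momentWeight μ σ).aestronglyMeasurable]
  exact ENNReal.toReal_le_of_le_ofReal hC h

theorem measure_univ_le (h : HasMomentBound μ σ C m) : m univ ≤ ENNReal.ofReal C := by
  refine le_trans ?_ h
  rw [← lintegral_one]
  exact lintegral_mono fun η => ENNReal.one_le_ofReal.2 (one_le_momentWeight μ σ η)

/-- A function which is dominated by the weight has a bounded integral. -/
theorem abs_integral_le (h : HasMomentBound μ σ C m) (hC : 0 ≤ C) {g : Quadrant → ℝ} {D : ℝ}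
    (hD : 0 ≤ D) (hg : ∀ᵐ η ∂m, |g η| ≤ D * momentWeight μ σ η) : |∫ η, g η ∂m| ≤ D * C := by
  have hg' : ∀ᵐ η ∂m, ‖g η‖ ≤ D * momentWeight μ σ η := hg
  -- No measurability of `g` is needed: a non-measurable integrand has Bochner integral zero. This
  -- allows `g` to be an inner integral.
  refine (norm_integral_le_of_norm_le (h.integrable.const_mul D) hg').trans ?_
  rw [integral_const_mul]
  exact mul_le_mul_of_nonneg_left (h.integral_le hC) hD

end HasMomentBound

/-- The kernel is at most `2 K₀ w(η) w(η')`, with `w` the moment weight, and the bracket is at most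
`3Φ`, so the double integral splits into a product of two moments. -/
theorem abs_coagulation_le {α β μ σ C Φ : ℝ} {K : Quadrant → Quadrant → ℝ}
    (hK : IsCoagulationKernel α β K) {K₀ : ℝ} (hK₀ : 0 < K₀)
    (hb : ∀ η η' : Quadrant,
      K η η' ≤ K₀ * ((η.2 : ℝ) ^ (-α) * (η'.2 : ℝ) ^ β + (η'.2 : ℝ) ^ (-α) * (η.2 : ℝ) ^ β))
    {m : RadonMeasure Quadrant} (hm : HasMomentBound μ σ C m.1) (hC : 0 ≤ C)
    {ψ : ℝ → ℝ → ℝ} (hψ : ∀ a v, |ψ a v| ≤ Φ) :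
    |coagulation K m ψ| ≤ 3 * K₀ * Φ * C * C := by
  have hΦ : 0 ≤ Φ := (abs_nonneg _).trans (hψ 0 0)
  obtain ⟨hβ0, hβ1⟩ := hK.beta_mem
  obtain ⟨hβα0, hβα1⟩ := hK.sub_mem
  have hα := hK.alpha_pos
  have hKw : ∀ η η', K η η' ≤ 2 * K₀ * momentWeight μ σ η * momentWeight μ σ η' := by
    intro η η'
    refine (hb η η').trans ?_
    have h1 := rpow_le_momentWeight μ σ (q := -α) (by linarith) (by linarith) η
    have h2 := rpow_le_momentWeight μ σ (q := β) (by linarith) (by linarith) η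
    have h1' := rpow_le_momentWeight μ σ (q := -α) (by linarith) (by linarith) η'
    have h2' := rpow_le_momentWeight μ σ (q := β) (by linarith) (by linarith) η'
    have hv : 0 < (η.2 : ℝ) := η.2.2
    have hv' : 0 < (η'.2 : ℝ) := η'.2.2
    have hw := zero_le_one.trans (one_le_momentWeight μ σ η)
    have hw' := zero_le_one.trans (one_le_momentWeight μ σ η')
    have e1 := mul_le_mul h1 h2' (Real.rpow_nonneg hv'.le _) hw
    have e2 := mul_le_mul h1' h2 (Real.rpow_nonneg hv.le _) hw'
    calc _ ≤ K₀ * (momentWeight μ σ η * momentWeight μ σ η'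
          + momentWeight μ σ η' * momentWeight μ σ η) := by gcongr
      _ = _ := by ring
  unfold coagulation
  rw [abs_mul, abs_of_pos (by norm_num : (0 : ℝ) < 1 / 2)]
  have key : |∫ η : Quadrant, ∫ η' : Quadrant,
      K η η' * (ψ (η.1 + η'.1) (η.2 + η'.2) - ψ η.1 η.2 - ψ η'.1 η'.2) ∂m.1 ∂m.1|
      ≤ (6 * K₀ * Φ * C) * C := by
    refine hm.abs_integral_le hC (by positivity) (ae_of_all _ fun η => ?_)
    have hw := zero_le_one.trans (one_le_momentWeight μ σ η)
    calc _ ≤ (6 * K₀ * Φ * momentWeight μ σ η) * C := by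
          refine hm.abs_integral_le hC (by positivity) (ae_of_all _ fun η' => ?_)
          have hw' := zero_le_one.trans (one_le_momentWeight μ σ η')
          have h3 : |ψ (η.1 + η'.1) (η.2 + η'.2) - ψ η.1 η.2 - ψ η'.1 η'.2| ≤ 3 * Φ := by
            have h1 := abs_le.1 (hψ (η.1 + η'.1) (η.2 + η'.2))
            have h2 := abs_le.1 (hψ η.1 η.2)
            have h3 := abs_le.1 (hψ η'.1 η'.2)
            exact abs_le.2 ⟨by linarith, by linarith⟩
          rw [abs_mul, abs_of_nonneg (hK.nonneg η η')]
          calc _ ≤ (2 * K₀ * momentWeight μ σ η * momentWeight μ σ η') * (3 * Φ) :=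
                mul_le_mul (hKw η η') h3 (abs_nonneg _) (by positivity)
            _ = _ := by ring
      _ = _ := by ring
  linarith

/-! ### Continuous functions with compact support -/

theorem isCompact_preimage_Icc {a b : ℝ} (ha : 0 < a) :
    IsCompact {x : PosReal | (x : ℝ) ∈ Icc a b} := by
  rw [Subtype.isCompact_iff]
  convert isCompact_Icc (a := a) (b := b) using 1
  ext x
  constructor
  · rintro ⟨y, hy, rfl⟩
    exact hy
  · intro hx
    exact ⟨⟨x, ha.trans_le hx.1⟩, hx, rfl⟩

theorem hasCompactSupport_of_box {h : Quadrant → ℝ} {a₁ a₂ v₁ v₂ : ℝ} (ha : 0 < a₁) (hv : 0 < v₁)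
    (hh : ∀ η : Quadrant, h η ≠ 0 → (η.1 : ℝ) ∈ Icc a₁ a₂ ∧ (η.2 : ℝ) ∈ Icc v₁ v₂) :
    HasCompactSupport h :=
  HasCompactSupport.of_support_subset_isCompact
    ((isCompact_preimage_Icc ha).prod (isCompact_preimage_Icc hv)) fun η hη => hh η hη

theorem continuous_sphereArea : Continuous sphereArea := by
  unfold sphereArea
  exact continuous_const.mul (Real.continuous_rpow_const (by norm_num))

theorem continuous_isoPoint : Continuous isoPoint :=
  ((continuous_sphereArea.comp continuous_subtype_val).subtype_mk _).prodMk continuous_id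

theorem IsFusionKernel.continuous {μ σ : ℝ} {r : ℝ → ℝ → ℝ} (hr : IsFusionKernel μ σ r) :
    Continuous fun η : Quadrant => r η.1 η.2 :=
  hr.contDiffOn.continuousOn.comp_continuous
    (f := fun η : Quadrant => ((η.1 : ℝ), (η.2 : ℝ))) (by fun_prop) fun η => ⟨η.1.2, η.2.2⟩

/-- A bump function on the line, supported near a positive point. -/
theorem exists_bump {c : ℝ} (hc : 0 < c) :
    ∃ b : ℝ → ℝ, ContDiff ℝ 1 b ∧ (∀ x, b x ∈ Icc (0 : ℝ) 1) ∧ b c = 1 ∧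
      ∀ x, b x ≠ 0 → x ∈ Icc (c / 2) (2 * c) := by
  let b : ContDiffBump c := ⟨c / 4, c / 2, by positivity, by linarith⟩
  refine ⟨b, b.contDiff, fun x => ⟨b.nonneg, b.le_one⟩,
    b.one_of_mem_closedBall (Metric.mem_closedBall_self (by positivity)), fun x hx => ?_⟩
  by_contra h
  refine hx (b.zero_of_le_dist ?_)
  change c / 2 ≤ dist x c
  rw [Real.dist_eq]
  by_contra! h'
  rw [abs_lt] at h'
  exact h ⟨by linarith, by linarith⟩

/-- A bounded primitive of a bump function. -/
theorem exists_primitive_bump {c : ℝ} (hc : 0 < c) {b : ℝ → ℝ} (hb : Continuous b)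
    (hb01 : ∀ x, b x ∈ Icc (0 : ℝ) 1) (hsupp : ∀ x, b x ≠ 0 → x ∈ Icc (c / 2) (2 * c)) :
    ∃ ρ : ℝ → ℝ, ContDiff ℝ 1 ρ ∧ (∀ x, deriv ρ x = b x) ∧ (∀ x, ρ x ≠ 0 → c / 2 ≤ x) ∧
      ∀ x, |ρ x| ≤ 2 * c := by
  have hder : ∀ x, deriv (fun x => ∫ y in (0 : ℝ)..x, b y) x = b x :=
    fun x => hb.deriv_integral b 0 x
  have hzero : ∀ x ≤ c / 2, ∫ y in (0 : ℝ)..x, b y = 0 := by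
    intro x hx
    rw [intervalIntegral.integral_congr_ae (g := fun _ => 0)]
    · simp
    -- The support hypothesis leaves `b (c / 2)` undetermined, so this endpoint is discarded as a
    -- null set.
    · have : ∀ᵐ y : ℝ, y ≠ c / 2 := by simp [ae_iff]
      filter_upwards [this] with y hy hy'
      by_contra h
      have h1 := (hsupp y h).1
      rcases mem_uIoc.1 hy' with h2 | h2
      · exact hy (le_antisymm (h2.2.trans hx) h1)
      · linarith [h2.2]
  refine ⟨fun x => ∫ y in (0 : ℝ)..x, b y, ?_, hder, fun x hx => ?_, fun x => ?_⟩
  · rw [contDiff_one_iff_deriv]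
    exact ⟨fun x => (hb.integral_hasStrictDerivAt 0 x).hasDerivAt.differentiableAt,
      by rwa [show deriv (fun x => ∫ y in (0 : ℝ)..x, b y) = b from funext hder]⟩
  · by_contra! h
    exact hx (hzero x h.le)
  · beta_reduce
    have hbound : ∀ u v : ℝ, |∫ y in u..v, b y| ≤ 1 * |v - u| := fun u v =>
      intervalIntegral.norm_integral_le_of_norm_le_const fun y _ => by
        rw [Real.norm_eq_abs, abs_of_nonneg (hb01 y).1]; exact (hb01 y).2
    -- The primitive vanishes to the left of `c / 2` and is constant beyond `2 * c`, so only the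
    -- length of `[0, 2c]` counts.
    rcases le_total x 0 with h0 | h0
    · rw [hzero x (by linarith)]; simp; positivity
    · rcases le_total x (2 * c) with h | h
      · refine (hbound 0 x).trans ?_
        rw [sub_zero, abs_of_nonneg h0]; linarith
      · have h2 : ∫ y in (2 * c)..x, b y = 0 := by
          rw [intervalIntegral.integral_congr_ae (g := fun _ => 0)]
          · simp
          · refine ae_of_all _ fun y hy => ?_
            by_contra h'
            rw [uIoc_of_le h] at hy
            linarith [(hsupp y h').2, hy.1]
        have h3 := intervalIntegral.integral_add_adjacent_intervals
          (hb.intervalIntegrable (μ := volume) 0 (2 * c)) (hb.intervalIntegrable (2 * c) x)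
        rw [h2, add_zero] at h3
        rw [← h3]
        refine (hbound 0 (2 * c)).trans ?_
        rw [sub_zero, abs_of_pos (by positivity)]; linarith

/-- A cutoff function around the origin. -/
theorem exists_cutoff {R : ℝ} (hR : 0 < R) :
    ∃ θ : ℝ → ℝ, ContDiff ℝ 1 θ ∧ (∀ x, θ x ∈ Icc (0 : ℝ) 1) ∧
      (∀ x, |x| ≤ R → θ x = 1) ∧ (∀ x, θ x ≠ 0 → |x| ≤ 2 * R) ∧
      (∀ x, deriv θ x ≠ 0 → |x| ∈ Icc R (2 * R)) ∧ ∃ D ≥ 0, ∀ x, |deriv θ x| ≤ D := by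
  let b : ContDiffBump (0 : ℝ) := ⟨R, 2 * R, hR, by linarith⟩
  have h1 : ∀ x, |x| ≤ R → b x = 1 := fun x hx =>
    b.one_of_mem_closedBall (by simpa using hx)
  have h2 : ∀ x, b x ≠ 0 → |x| ≤ 2 * R := by
    intro x hx
    by_contra! h
    exact hx (b.zero_of_le_dist (by simpa using h.le))
  have hc : ContDiff ℝ 1 b := b.contDiff
  refine ⟨b, hc, fun x => ⟨b.nonneg, b.le_one⟩, h1, h2, fun x hx => ?_, ?_⟩
  · by_contra h
    rw [mem_Icc, not_and_or, not_le, not_le] at h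
    rcases h with h | h
    · have he : b =ᶠ[𝓝 x] fun _ => 1 := by
        filter_upwards [(isOpen_Iio.preimage continuous_abs).mem_nhds h] with y hy
        exact h1 y (le_of_lt hy)
      exact hx (by rw [he.deriv_eq, deriv_const])
    · have he : b =ᶠ[𝓝 x] fun _ => 0 := by
        filter_upwards [(isOpen_Ioi.preimage continuous_abs).mem_nhds h] with y hy
        by_contra hne
        exact not_le_of_gt hy (h2 y hne)
      exact hx (by rw [he.deriv_eq, deriv_const])
  · obtain ⟨D, hD⟩ := b.hasCompactSupport.deriv.exists_bound_of_continuous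
      (hc.continuous_deriv le_rfl)
    exact ⟨D, (norm_nonneg _).trans (hD 0), hD⟩

theorem isTestFunction_mul {τ χ g : ℝ → ℝ} (hτ : ContDiff ℝ 1 τ) (hχ : ContDiff ℝ 1 χ)
    (hg : ContDiff ℝ 1 g) {t₁ t₂ v₁ v₂ a₁ a₂ : ℝ} (hv : 0 < v₁) (ha : 0 < a₁)
    (hτs : ∀ x, τ x ≠ 0 → x ∈ Icc t₁ t₂) (hχs : ∀ x, χ x ≠ 0 → x ∈ Icc v₁ v₂)
    (hgs : ∀ x, g x ≠ 0 → x ∈ Icc a₁ a₂) :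
    IsTestFunction fun s a v => τ s * (χ v * g a) := by
  have hK : IsCompact (Icc t₁ t₂ ×ˢ (Icc a₁ a₂ ×ˢ Icc v₁ v₂)) :=
    isCompact_Icc.prod (isCompact_Icc.prod isCompact_Icc)
  have hsub : Function.support (fun p : ℝ × ℝ × ℝ => τ p.1 * (χ p.2.2 * g p.2.1)) ⊆
      Icc t₁ t₂ ×ˢ (Icc a₁ a₂ ×ˢ Icc v₁ v₂) := by
    intro p hp
    rw [Function.mem_support, mul_ne_zero_iff, mul_ne_zero_iff] at hp
    exact ⟨hτs _ hp.1, hgs _ hp.2.2, hχs _ hp.2.1⟩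
  refine ⟨by fun_prop, HasCompactSupport.of_support_subset_isCompact hK hsub, fun p hp => ?_⟩
  have hp' := closure_minimal hsub hK.isClosed hp
  exact ⟨ha.trans_le hp'.2.1.1, hv.trans_le hp'.2.2.1⟩

/-! ### The flux towards the isoperimetric line -/

/-- Away from a factor `ε`, the fusion term of the weak formulation is bounded uniformly in `ε`. -/
theorem abs_fusion_integral_le {α β μ σ : ℝ} {K : Quadrant → Quadrant → ℝ}
    (hK : IsCoagulationKernel α β K) {K₀ : ℝ} (hK₀ : 0 < K₀)
    (hb : ∀ η η' : Quadrant,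
      K η η' ≤ K₀ * ((η.2 : ℝ) ^ (-α) * (η'.2 : ℝ) ^ β + (η'.2 : ℝ) ^ (-α) * (η.2 : ℝ) ^ β))
    {r : ℝ → ℝ → ℝ} {m₀ : RadonMeasure Quadrant} {T C : ℝ} (hT : 0 < T) (hC : 0 ≤ C)
    {ε : ℝ} (hε : 0 < ε) {f : ℝ → RadonMeasure Quadrant}
    (hf : IsFusionSolution α β K r ε m₀ f)
    (hmom : ∀ t ∈ Icc 0 T, HasMomentBound μ σ C (f t).1)
    {χ g : ℝ → ℝ} (hχ : ContDiff ℝ 1 χ)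
    (hg : ContDiff ℝ 1 g) {v₁ v₂ a₁ a₂ : ℝ} (hv : 0 < v₁) (ha : 0 < a₁)
    (hχs : ∀ x, χ x ≠ 0 → x ∈ Icc v₁ v₂) (hgs : ∀ x, g x ≠ 0 → x ∈ Icc a₁ a₂)
    {Φ : ℝ} (hΦ : ∀ a v, |χ v * g a| ≤ Φ) :
    |∫ s in (0 : ℝ)..T, ∫ η : Quadrant,
        r η.1 η.2 * (sphereArea η.2 - η.1) * (χ η.2 * deriv g η.1) ∂(f s).1|
      ≤ ε * (Φ * C + |∫ η : Quadrant, χ η.2 * g η.1 ∂m₀.1| + 3 * K₀ * Φ * C * C * T) := by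
  -- The plateau of radius `T + 1` extends strictly beyond `[0, T]`, so `τ = 1` and `τ' = 0` there:
  -- the test function is compactly supported in time and yet the time-derivative term drops out.
  obtain ⟨τ, hτ, hτ01, hτ1, hτs, hτd, -⟩ := exists_cutoff (R := T + 1) (by linarith)
  have hΦ0 : 0 ≤ Φ := (abs_nonneg _).trans (hΦ 0 0)
  have htest : IsTestFunction fun s a v => τ s * (χ v * g a) :=
    isTestFunction_mul hτ hχ hg hv ha (fun x hx => abs_le.1 (hτs x hx)) hχs hgs
  have hw := hf.weak _ htest T hT.le
  have hτT : τ T = 1 := hτ1 T (by rw [abs_of_pos hT]; linarith)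
  have hτ0 : τ 0 = 1 := hτ1 0 (by rw [abs_zero]; linarith)
  have hmemI : ∀ s ∈ uIcc 0 T, s ∈ Icc 0 T := fun s hs => by rwa [uIcc_of_le hT.le] at hs
  have hder : ∫ s in (0 : ℝ)..T, ∫ η : Quadrant,
      deriv (fun t => τ t * (χ η.2 * g η.1)) s ∂(f s).1 = 0 := by
    rw [intervalIntegral.integral_congr (g := fun _ => (0 : ℝ)), intervalIntegral.integral_zero]
    intro s hs
    have hs' := hmemI s hs
    have : deriv τ s = 0 := by
      by_contra h
      have := (hτd s h).1
      rw [abs_of_nonneg hs'.1] at this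
      linarith [hs'.2]
    have hd : ∀ y : ℝ, deriv (fun t => τ t * y) s = 0 := fun y => by
      rw [deriv_mul_const_field, this, zero_mul]
    simp only [hd, integral_zero]
  have hflux : ∫ s in (0 : ℝ)..T, ∫ η : Quadrant,
        r η.1 η.2 * (sphereArea η.2 - η.1) * deriv (fun x => τ s * (χ η.2 * g x)) η.1 ∂(f s).1
      = ∫ s in (0 : ℝ)..T, ∫ η : Quadrant,
        r η.1 η.2 * (sphereArea η.2 - η.1) * (χ η.2 * deriv g η.1) ∂(f s).1 := by
    refine intervalIntegral.integral_congr fun s hs => ?_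
    have hs' := hmemI s hs
    have : τ s = 1 := hτ1 s (by rw [abs_of_nonneg hs'.1]; linarith [hs'.2])
    simp only [this, one_mul, deriv_const_mul_field]
  simp only [hτT, hτ0, one_mul] at hw
  rw [hder, hflux] at hw
  have hend : |∫ η : Quadrant, χ η.2 * g η.1 ∂(f T).1| ≤ Φ * C :=
    (hmom T ⟨hT.le, le_rfl⟩).abs_integral_le hC hΦ0 <| ae_of_all _ fun η =>
      (hΦ _ _).trans (le_mul_of_one_le_right hΦ0 (one_le_momentWeight μ σ η))
  have hcoag : |∫ s in (0 : ℝ)..T, coagulation K (f s) fun a v => τ s * (χ v * g a)|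
      ≤ 3 * K₀ * Φ * C * C * T := by
    have := intervalIntegral.norm_integral_le_of_norm_le_const (a := 0) (b := T)
      (f := fun s => coagulation K (f s) fun a v => τ s * (χ v * g a))
      (C := 3 * K₀ * Φ * C * C) fun s hs => by
        rw [uIoc_of_le hT.le] at hs
        refine abs_coagulation_le hK hK₀ hb (hmom s ⟨hs.1.le, hs.2⟩) hC fun a v => ?_
        rw [abs_mul, abs_of_nonneg (hτ01 s).1]
        exact (mul_le_of_le_one_left (abs_nonneg _) (hτ01 s).2).trans (hΦ a v)
    rwa [sub_zero, abs_of_pos hT] at this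
  set J := ∫ s in (0 : ℝ)..T, ∫ η : Quadrant,
        r η.1 η.2 * (sphereArea η.2 - η.1) * (χ η.2 * deriv g η.1) ∂(f s).1
  have hJ : J = ε * ((∫ η : Quadrant, χ η.2 * g η.1 ∂(f T).1)
      - (∫ η : Quadrant, χ η.2 * g η.1 ∂m₀.1)
      - ∫ s in (0 : ℝ)..T, coagulation K (f s) fun a v => τ s * (χ v * g a)) := by
    rw [sub_zero] at hw
    rw [hw]
    field_simp
    ring
  rw [hJ, abs_mul, abs_of_pos hε]
  gcongr
  exact (abs_sub _ _).trans (add_le_add ((abs_sub _ _).trans (add_le_add hend le_rfl)) hcoag)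

/-! ### The volume marginal of measures on the isoperimetric line -/

/-- For measures that are concentrated on the isoperimetric line, the volume marginal is continuous
against functions of compact support. -/
theorem continuousOn_integral_snd {ν : ℝ → Measure Quadrant} {s : Set ℝ}
    (hcont : ∀ φ : C_c(Quadrant, ℝ), ContinuousOn (fun t => ∫ η, φ η ∂ν t) s)
    (hline : ∀ t ∈ s, ∀ᵐ η ∂ν t, (η.1 : ℝ) = sphereArea η.2)
    {φ : PosReal → ℝ} (hφ : Continuous φ) (hφc : HasCompactSupport φ) :
    ContinuousOn (fun t => ∫ η, φ η.2 ∂ν t) s := by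
  -- A function of `v` alone is not compactly supported in the quadrant. The factor `b (a /
  -- sphereArea v)` repairs this and equals `1` on the line, so the integrals are unchanged.
  obtain ⟨b, hb, -, hb1, hbs⟩ := exists_bump one_pos
  have hcs : Continuous fun η : Quadrant => φ η.2 * b (η.1 / sphereArea η.2) := by
    refine (hφ.comp continuous_snd).mul (hb.continuous.comp ?_)
    exact (continuous_subtype_val.comp continuous_fst).div₀
      (continuous_sphereArea.comp (continuous_subtype_val.comp continuous_snd))
      fun η => (sphereArea_pos η.2.2).ne'
  have hsupp : HasCompactSupport fun η : Quadrant => φ η.2 * b (η.1 / sphereArea η.2) := by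
    -- In the coordinates `(a / sphereArea v, v)` the support lies in a product of compact sets; `Ψ`
    -- is the inverse change of coordinates.
    let Ψ : PosReal × PosReal → Quadrant := fun p =>
      (⟨p.1 * sphereArea p.2, mul_pos p.1.2 (sphereArea_pos p.2.2)⟩, p.2)
    have hΨ : Continuous Ψ := by
      refine (Continuous.subtype_mk ?_ _).prodMk continuous_snd
      exact (continuous_subtype_val.comp continuous_fst).mul
        (continuous_sphereArea.comp (continuous_subtype_val.comp continuous_snd))
    refine HasCompactSupport.of_support_subset_isCompact
      (((isCompact_preimage_Icc (a := 1 / 2) (b := 2 * 1) (by norm_num)).prod hφc).image hΨ) ?_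
    intro η hη
    rw [Function.mem_support, mul_ne_zero_iff] at hη
    refine ⟨(⟨η.1 / sphereArea η.2, div_pos η.1.2 (sphereArea_pos η.2.2)⟩, η.2),
      ⟨hbs _ hη.2, subset_tsupport φ hη.1⟩, ?_⟩
    exact Prod.ext (Subtype.ext (div_mul_cancel₀ _ (sphereArea_pos η.2.2).ne')) rfl
  refine (hcont ⟨⟨_, hcs⟩, hsupp⟩).congr fun t ht => integral_congr_ae ?_
  filter_upwards [hline t ht] with η hη
  change φ η.2 = φ η.2 * b (η.1 / sphereArea η.2)
  rw [hη, div_self (sphereArea_pos η.2.2).ne', hb1, mul_one]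

/-- A function that vanishes at infinity is a uniform limit of functions with compact support. -/
theorem exists_hasCompactSupport_abs_sub_le {X : Type*} [TopologicalSpace X] [R1Space X]
    (φ : C₀(X, ℝ))
    {δ : ℝ} (hδ : 0 < δ) :
    ∃ g : X → ℝ, Continuous g ∧ HasCompactSupport g ∧ ∀ x, |φ x - g x| ≤ δ := by
  -- Soft thresholding: values in `[-δ, δ]` become zero and the others move by `δ` towards zero.
  refine ⟨fun x => max (φ x - δ) 0 + min (φ x + δ) 0, ?_, ?_, fun x => ?_⟩
  · have := φ.continuous
    fun_prop
  · have h := φ.zero_at_infty'.eventually (Metric.ball_mem_nhds (0 : ℝ) hδ)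
    obtain ⟨k, hk, hkφ⟩ := mem_cocompact.1 h
    refine HasCompactSupport.of_support_subset_isCompact
      (K := {x | δ ≤ |φ x|}) ?_ ?_
    · refine hk.of_isClosed_subset (isClosed_le continuous_const φ.continuous.abs) fun x hx => ?_
      by_contra hx'
      have : φ x ∈ Metric.ball (0 : ℝ) δ := hkφ hx'
      rw [mem_ball_zero_iff, Real.norm_eq_abs] at this
      exact not_lt_of_ge hx this
    · intro x hx
      by_contra hlt
      rw [mem_ofPred_eq, not_le, abs_lt] at hlt
      apply hx
      change max (φ x - δ) 0 + min (φ x + δ) 0 = 0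
      rw [max_eq_right (by linarith [hlt.2]), min_eq_right (by linarith [hlt.1]), add_zero]
  · rw [abs_le]
    rcases max_cases (φ x - δ) 0 with h | h <;> rcases min_cases (φ x + δ) 0 with h' | h' <;>
      constructor <;> linarith

/-- Continuity against `C_c` and a uniform bound of the mass give continuity against `C₀`. -/
theorem continuousOn_integral_zeroAtInfty {X : Type*} [TopologicalSpace X] [MeasurableSpace X]
    [R1Space X] [OpensMeasurableSpace X] {ν : ℝ → Measure X} {s : Set ℝ} {C : ℝ} (hC : 0 ≤ C)
    (hmass : ∀ t ∈ s, ν t univ ≤ ENNReal.ofReal C)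
    (hcont : ∀ φ : X → ℝ, Continuous φ → HasCompactSupport φ →
      ContinuousOn (fun t => ∫ x, φ x ∂ν t) s) (φ : C₀(X, ℝ)) :
    ContinuousOn (fun t => ∫ x, φ x ∂ν t) s := by
  have hint : ∀ t ∈ s, ∀ g : X → ℝ, Continuous g → (∃ B, ∀ x, |g x| ≤ B) →
      Integrable g (ν t) := by
    rintro t ht g hg ⟨B, hB⟩
    have : IsFiniteMeasure (ν t) := ⟨(hmass t ht).trans_lt ENNReal.ofReal_lt_top⟩
    exact Integrable.of_bound hg.aestronglyMeasurable B (ae_of_all _ hB)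
  refine continuousOn_of_uniform_approx_of_continuousOn fun U hU => ?_
  obtain ⟨δ, hδ, hδU⟩ := Metric.mem_uniformity_dist.1 hU
  obtain ⟨g, hg, hgc, hφg⟩ := exists_hasCompactSupport_abs_sub_le φ
    (div_pos hδ (by linarith : 0 < C + 1))
  refine ⟨fun t => ∫ x, g x ∂ν t, hcont g hg hgc, fun t ht => hδU ?_⟩
  have : IsFiniteMeasure (ν t) := ⟨(hmass t ht).trans_lt ENNReal.ofReal_lt_top⟩
  have hφ : Integrable φ (ν t) :=
    hint t ht φ φ.continuous ⟨‖φ.toBCF‖, fun x => φ.toBCF.norm_coe_le_norm x⟩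
  have hgi : Integrable g (ν t) := hint t ht g hg (hgc.exists_bound_of_continuous hg)
  rw [Real.dist_eq, ← integral_sub hφ hgi]
  have hreal : (ν t).real univ ≤ C := ENNReal.toReal_le_of_le_ofReal hC (hmass t ht)
  have hφg' : ∀ x, ‖φ x - g x‖ ≤ δ / (C + 1) := hφg
  calc |∫ x, φ x - g x ∂ν t| ≤ δ / (C + 1) * (ν t).real univ :=
        norm_integral_le_of_norm_le_const (ae_of_all _ hφg')
    _ ≤ δ / (C + 1) * C := by gcongr
    _ < δ := by
        rw [div_mul_eq_mul_div, div_lt_iff₀ (by linarith)]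
        nlinarith

/-! ### Concentration on the isoperimetric line -/

theorem ae_sphereArea_le {m : RadonMeasure Quadrant} (hm : m ∈ isoperimetricMeasures) :
    ∀ᵐ η ∂m.1, sphereArea η.2 ≤ (η.1 : ℝ) := by
  rw [ae_iff]
  simpa only [not_le] using (show m.1 {η : Quadrant | (η.1 : ℝ) < sphereArea η.2} = 0 from hm)

/-- The contribution to the flux of a cutoff at large areas `M` is small. -/
theorem abs_cutoff_flux_le {μ σ : ℝ} {r : ℝ → ℝ → ℝ} {R₁ : ℝ} (hR₁ : 0 < R₁)
    (hr0 : ∀ a > 0, ∀ v > 0, 0 ≤ r a v)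
    (hr : ∀ a > 0, ∀ v > 0, r a v ≤ R₁ * (a ^ μ * v ^ σ)) {χ ρ θ' : ℝ → ℝ} {v₁ v₂ V P D M : ℝ}
    (hχ : ∀ x, χ x ∈ Icc (0 : ℝ) 1) (hχs : ∀ x, χ x ≠ 0 → x ∈ Icc v₁ v₂)
    (hV : ∀ x ∈ Icc v₁ v₂, x ^ σ ≤ V) (hV0 : 0 ≤ V) (hρ : ∀ x, |ρ x| ≤ P) (hD : ∀ x, |θ' x| ≤ D)
    (hθs : ∀ x, θ' x ≠ 0 → |x| ∈ Icc (1 : ℝ) (2 * 1)) (hM : 1 ≤ M) (η : Quadrant)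
    (hη : sphereArea η.2 ≤ η.1) :
    |r η.1 η.2 * (η.1 - sphereArea η.2) * (χ η.2 * (ρ η.1 * (θ' (η.1 / M) / M)))|
      ≤ (2 * R₁ * V * P * D) / M * momentWeight μ σ η := by
  have hv : 0 < (η.2 : ℝ) := η.2.2
  have ha : 0 < (η.1 : ℝ) := η.1.2
  have hM0 : 0 < M := by linarith
  have hP0 : 0 ≤ P := (abs_nonneg _).trans (hρ 0)
  have hD0 : 0 ≤ D := (abs_nonneg _).trans (hD 0)
  have hw := zero_le_one.trans (one_le_momentWeight μ σ η)
  by_cases h : χ η.2 ≠ 0 ∧ θ' (η.1 / M) ≠ 0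
  · have hvV := hV _ (hχs _ h.1)
    obtain ⟨h1, h2⟩ := hθs _ h.2
    rw [abs_of_pos (div_pos ha hM0)] at h1 h2
    rw [le_div_iff₀ hM0, one_mul] at h1
    rw [div_le_iff₀ hM0, mul_one] at h2
    have hw' := rpow_area_le_momentWeight μ σ hM η h1
    have hs := sphereArea_pos hv
    have hap := Real.rpow_nonneg ha.le μ
    have e1 : |r η.1 η.2| ≤ R₁ * (momentWeight μ σ η / M * V) := by
      rw [abs_of_nonneg (hr0 _ ha _ hv)]
      exact (hr _ ha _ hv).trans (by gcongr)
    have e2 : |(η.1 : ℝ) - sphereArea η.2| ≤ 2 * M := by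
      rw [abs_of_nonneg (by linarith)]; linarith
    have e3 : |χ η.2| ≤ 1 := by rw [abs_of_nonneg (hχ _).1]; exact (hχ _).2
    rw [abs_mul, abs_mul, abs_mul, abs_mul, abs_div, abs_of_pos hM0]
    -- The distance to the line, at most `2 * M`, cancels the `1 / M` from differentiating the
    -- cutoff; what remains is the `1 / M` gained from the weight.
    calc _ ≤ (R₁ * (momentWeight μ σ η / M * V)) * (2 * M) * (1 * (P * (D / M))) := by
          gcongr
          · exact hρ _
          · exact hD _
      _ = _ := by field_simp
  · have h0 : r η.1 η.2 * (η.1 - sphereArea η.2) * (χ η.2 * (ρ η.1 * (θ' (η.1 / M) / M))) = 0 := by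
      rw [not_and_or, not_not, not_not] at h
      rcases h with h | h <;> simp [h]
    rw [h0, abs_zero]
    positivity

theorem IsFusionSolution.continuousOn_integral {α β Λ : ℝ} {K : Quadrant → Quadrant → ℝ}
    {r : ℝ → ℝ → ℝ} {m₀ : RadonMeasure Quadrant} {f : ℝ → RadonMeasure Quadrant}
    (hf : IsFusionSolution α β K r Λ m₀ f) (φ : C_c(Quadrant, ℝ)) :
    ContinuousOn (fun t => ∫ η, φ η ∂(f t).1) (Ici 0) :=
  continuousOn_radonMeasure_iff.1 hf.continuousOn φ

/-- Near every point off the isoperimetric line there is a function whose integral against the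
solutions tends to zero with `ε`. -/
theorem exists_localized_flux {α β μ σ : ℝ} {K : Quadrant → Quadrant → ℝ}
    (hK : IsCoagulationKernel α β K) {r : ℝ → ℝ → ℝ} (hr : IsFusionKernel μ σ r)
    (m₀ : RadonMeasure Quadrant) {T C : ℝ} (hT : 0 < T) (hC : 0 ≤ C) (η₀ : Quadrant)
    (hη₀ : sphereArea η₀.2 < η₀.1) :
    ∃ ψ : C_c(Quadrant, ℝ), (∀ η : Quadrant, sphereArea η.2 ≤ η.1 → 0 ≤ ψ η) ∧ ψ η₀ ≠ 0 ∧
      ∀ δ > 0, ∃ E : ℝ, ∀ ε ∈ Ioo (0 : ℝ) 1, ∀ f : ℝ → RadonMeasure Quadrant,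
        IsFusionSolution α β K r ε m₀ f → (∀ t ∈ Icc 0 T, HasMomentBound μ σ C (f t).1) →
        |∫ s in (0 : ℝ)..T, ∫ η, ψ η ∂(f s).1| ≤ δ + ε * E := by
  obtain ⟨K₁, -, K₀, hK₀, hKb⟩ := hK.bounds
  obtain ⟨R₀, hR₀, R₁, hR₁, hrb⟩ := hr.bounds
  have hr0 : ∀ a > 0, ∀ v > 0, 0 < r a v := fun a ha v hv =>
    lt_of_lt_of_le (by positivity) (hrb a ha v hv).1
  obtain ⟨⟨a₀, ha₀⟩, ⟨v₀, hv₀⟩⟩ := η₀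
  change 0 < a₀ at ha₀
  change 0 < v₀ at hv₀
  change sphereArea v₀ < a₀ at hη₀
  obtain ⟨χ, hχ, hχ01, hχ1, hχs⟩ := exists_bump hv₀
  obtain ⟨b, hb, hb01, hb1, hbs⟩ := exists_bump ha₀
  obtain ⟨ρ, hρ, hρd, hρs, hρb⟩ := exists_primitive_bump ha₀ hb.continuous hb01 hbs
  obtain ⟨θ, hθ, hθ01, hθ1, hθs, hθd, D, hD0, hD⟩ := exists_cutoff one_pos
  have hflux : Continuous fun η : Quadrant => r η.1 η.2 * (η.1 - sphereArea η.2) :=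
    hr.continuous.mul ((continuous_subtype_val.comp continuous_fst).sub
      (continuous_sphereArea.comp (continuous_subtype_val.comp continuous_snd)))
  have hψc : Continuous fun η : Quadrant =>
      r η.1 η.2 * (η.1 - sphereArea η.2) * (χ η.2 * b η.1) := by
    have := hχ.continuous
    have := hb.continuous
    fun_prop
  have hψs : HasCompactSupport fun η : Quadrant =>
      r η.1 η.2 * (η.1 - sphereArea η.2) * (χ η.2 * b η.1) := by
    refine hasCompactSupport_of_box (a₂ := 2 * a₀) (v₂ := 2 * v₀) (half_pos ha₀) (half_pos hv₀) fun η hη => ?_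
    rw [mul_ne_zero_iff, mul_ne_zero_iff, mul_ne_zero_iff] at hη
    exact ⟨hbs _ hη.2.2, hχs _ hη.2.1⟩
  -- On the support of `χ` the factor `v ^ σ` is bounded whatever the sign of `σ`, so only large
  -- areas need the weight.
  obtain ⟨V, hV⟩ := isCompact_Icc.exists_bound_of_continuousOn
    (s := Icc (v₀ / 2) (2 * v₀)) (f := fun x : ℝ => x ^ σ)
    (continuousOn_id.rpow_const fun x hx => Or.inl (ne_of_gt ((half_pos hv₀).trans_le hx.1)))
  have hV' : ∀ x ∈ Icc (v₀ / 2) (2 * v₀), x ^ σ ≤ V := fun x hx => (le_abs_self _).trans (hV x hx)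
  have hV0 : 0 ≤ V := (norm_nonneg _).trans (hV v₀ ⟨by linarith, by linarith⟩)
  refine ⟨⟨⟨_, hψc⟩, hψs⟩, fun η hη => ?_, ?_, fun δ hδ => ?_⟩
  · exact mul_nonneg (mul_nonneg (hr0 _ η.1.2 _ η.2.2).le (sub_nonneg.2 hη))
      (mul_nonneg (hχ01 _).1 (hb01 _).1)
  · change r a₀ v₀ * (a₀ - sphereArea v₀) * (χ v₀ * b a₀) ≠ 0
    rw [hχ1, hb1]
    have := hr0 _ ha₀ _ hv₀
    have := sub_pos.2 hη₀
    positivity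
  set Q := 2 * R₁ * V * (2 * a₀) * D with hQ
  have hQ0 : 0 ≤ Q := by positivity
  -- `Q` does not depend on `M`. The three conditions provide the gain from the weight, make the
  -- cutoff equal to `1` on the support of `b`, and bring the cutoff error below `δ`.
  obtain ⟨M, hM1, hMa, hMδ⟩ : ∃ M : ℝ, 1 ≤ M ∧ 2 * a₀ ≤ M ∧ Q / M * C * T ≤ δ := by
    refine ⟨max 1 (max (2 * a₀) (Q * C * T / δ)), le_max_left _ _,
      (le_max_left _ _).trans (le_max_right _ _), ?_⟩
    have hpos : 0 < max 1 (max (2 * a₀) (Q * C * T / δ)) := lt_max_of_lt_left one_pos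
    have : Q * C * T / δ ≤ max 1 (max (2 * a₀) (Q * C * T / δ)) :=
      (le_max_right _ _).trans (le_max_right _ _)
    rw [div_le_iff₀ hδ] at this
    calc _ = Q * C * T / max 1 (max (2 * a₀) (Q * C * T / δ)) := by ring
      _ ≤ δ := by rw [div_le_iff₀ hpos]; linarith
  have hM0 : 0 < M := by linarith
  have hg : ContDiff ℝ 1 fun x => ρ x * θ (x / M) := by fun_prop
  have hgs : ∀ x, ρ x * θ (x / M) ≠ 0 → x ∈ Icc (a₀ / 2) (2 * M) := by
    intro x hx
    rw [mul_ne_zero_iff] at hx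
    refine ⟨hρs _ hx.1, ?_⟩
    have := (le_abs_self _).trans (hθs _ hx.2)
    rw [div_le_iff₀ hM0] at this
    linarith
  have hgd : ∀ x, deriv (fun x => ρ x * θ (x / M)) x = b x + ρ x * (deriv θ (x / M) / M) := by
    intro x
    have h1 : HasDerivAt ρ (b x) x := by
      rw [← hρd x]
      exact (hρ.differentiable one_ne_zero x).hasDerivAt
    have h2 : HasDerivAt (fun x => θ (x / M)) (deriv θ (x / M) * (1 / M)) x :=
      (hθ.differentiable one_ne_zero (x / M)).hasDerivAt.comp x ((hasDerivAt_id x).div_const M)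
    refine (h1.mul h2).deriv.trans ?_
    have h3 : b x * θ (x / M) = b x := by
      by_cases h : b x = 0
      · rw [h, zero_mul]
      · have hx := hbs x h
        rw [hθ1 (x / M), mul_one]
        rw [abs_of_nonneg (div_nonneg (by linarith [hx.1]) hM0.le), div_le_iff₀ hM0]
        linarith [hx.2]
    rw [h3]
    ring
  have hΦ : ∀ a v, |χ v * (ρ a * θ (a / M))| ≤ 2 * a₀ := by
    intro a v
    rw [abs_mul, abs_mul, abs_of_nonneg (hχ01 v).1, abs_of_nonneg (hθ01 _).1]
    calc _ ≤ 1 * (2 * a₀ * 1) := by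
          gcongr
          · exact mul_nonneg (abs_nonneg _) (hθ01 _).1
          · exact (hχ01 _).2
          · exact (hθ01 _).1
          · exact hρb _
          · exact (hθ01 _).2
      _ = _ := by ring
  -- The error part of the flux, where the derivative falls on the cutoff instead of on `ρ`.
  let N : Quadrant → ℝ := fun η =>
    r η.1 η.2 * (η.1 - sphereArea η.2) * (χ η.2 * (ρ η.1 * (deriv θ (η.1 / M) / M)))
  have hNc : Continuous N := by
    have := hχ.continuous
    have := hρ.continuous
    have := hθ.continuous_deriv le_rfl
    fun_prop
  have hNs : HasCompactSupport N := by
    refine hasCompactSupport_of_box (a₂ := 2 * M) (v₂ := 2 * v₀) (half_pos ha₀) (half_pos hv₀) fun η hη => ?_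
    simp only [N, mul_ne_zero_iff, div_ne_zero_iff] at hη
    refine ⟨⟨hρs _ hη.2.2.1, ?_⟩, hχs _ hη.2.1⟩
    have := (le_abs_self _).trans (hθd _ hη.2.2.2.1).2
    rw [div_le_iff₀ hM0] at this
    linarith
  let ψ : C_c(Quadrant, ℝ) := ⟨⟨_, hψc⟩, hψs⟩
  let N' : C_c(Quadrant, ℝ) := ⟨⟨_, hNc⟩, hNs⟩
  -- This constant depends on `δ` through `M`, in the term with the initial datum, but not on `ε` or
  -- `f`; hence the order of the quantifiers.
  refine ⟨2 * a₀ * C + |∫ η : Quadrant, χ η.2 * (ρ η.1 * θ (η.1 / M)) ∂m₀.1|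
    + 3 * K₀ * (2 * a₀) * C * C * T, fun ε hε f hf hmom => ?_⟩
  change |∫ s in (0 : ℝ)..T, ∫ η, ψ η ∂(f s).1| ≤ _
  have h1 := abs_fusion_integral_le hK hK₀ (fun η η' => (hKb η η').2) hT hC hε.1 hf hmom hχ hg
    (half_pos hv₀) (half_pos ha₀) hχs hgs hΦ
  have hii : ∀ φ : C_c(Quadrant, ℝ),
      IntervalIntegrable (fun s => ∫ η, φ η ∂(f s).1) volume 0 T := fun φ =>
    ((hf.continuousOn_integral φ).mono fun s hs => by
      rw [uIcc_of_le hT.le] at hs; exact hs.1).intervalIntegrable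
  have hsplit : ∫ s in (0 : ℝ)..T, ∫ η : Quadrant, r η.1 η.2 * (sphereArea η.2 - η.1) *
      (χ η.2 * deriv (fun x => ρ x * θ (x / M)) η.1) ∂(f s).1
      = -((∫ s in (0 : ℝ)..T, ∫ η, ψ η ∂(f s).1) + ∫ s in (0 : ℝ)..T, ∫ η, N' η ∂(f s).1) := by
    rw [← intervalIntegral.integral_add (hii ψ) (hii N'), ← intervalIntegral.integral_neg]
    refine intervalIntegral.integral_congr fun s _ => ?_
    have := (f s).2
    have e1 : Integrable (fun η => ψ η) (f s).1 :=
      ψ.continuous.integrable_of_hasCompactSupport ψ.hasCompactSupport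
    have e2 : Integrable (fun η => N' η) (f s).1 :=
      N'.continuous.integrable_of_hasCompactSupport N'.hasCompactSupport
    rw [← integral_add e1 e2, ← integral_neg]
    refine integral_congr_ae (ae_of_all _ fun η => ?_)
    beta_reduce
    rw [hgd]
    change _ = -(r η.1 η.2 * (η.1 - sphereArea η.2) * (χ η.2 * b η.1) +
      r η.1 η.2 * (η.1 - sphereArea η.2) * (χ η.2 * (ρ η.1 * (deriv θ (η.1 / M) / M))))
    ring
  rw [hsplit, abs_neg] at h1
  have h2 : |∫ s in (0 : ℝ)..T, ∫ η, N' η ∂(f s).1| ≤ Q / M * C * T := by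
    have := intervalIntegral.norm_integral_le_of_norm_le_const (a := 0) (b := T)
      (f := fun s => ∫ η, N' η ∂(f s).1) (C := Q / M * C) fun s hs => by
        rw [uIoc_of_le hT.le] at hs
        refine (hmom s ⟨hs.1.le, hs.2⟩).abs_integral_le hC (by positivity) ?_
        filter_upwards [ae_sphereArea_le (hf.mem s hs.1.le)] with η hη
        exact abs_cutoff_flux_le hR₁ (fun a ha v hv => (hr0 a ha v hv).le)
          (fun a ha v hv => (hrb a ha v hv).2) hχ01 hχs hV' hV0 hρb hD hθd hM1 η hη
    rwa [sub_zero, abs_of_pos hT] at this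
  have h3 := abs_sub_abs_le_abs_sub (∫ s in (0 : ℝ)..T, ∫ η, ψ η ∂(f s).1)
    (-∫ s in (0 : ℝ)..T, ∫ η, N' η ∂(f s).1)
  rw [sub_neg_eq_add, abs_neg] at h3
  linarith

/-- A family of nonnegative functions whose integrals over `[0, T]` tend to zero can only converge
to a continuous limit if the limit vanishes. -/
theorem eqOn_zero_of_tendsto_integral {T B : ℝ} (hT : 0 < T) {J : ℕ → ℝ → ℝ} {j : ℝ → ℝ}
    (hJ : ∀ n, ContinuousOn (J n) (Icc 0 T)) (hB : ∀ n, ∀ s ∈ Icc 0 T, |J n s| ≤ B)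
    (hlim : ∀ s ∈ Ioc 0 T, Tendsto (fun n => J n s) atTop (𝓝 (j s)))
    (hj : ContinuousOn j (Ioc 0 T)) (hj0 : ∀ s ∈ Ioc 0 T, 0 ≤ j s)
    (hint : Tendsto (fun n => ∫ s in (0 : ℝ)..T, J n s) atTop (𝓝 0)) : EqOn j 0 (Ioc 0 T) := by
  have h1 : Tendsto (fun n => ∫ s in (0 : ℝ)..T, J n s) atTop (𝓝 (∫ s in (0 : ℝ)..T, j s)) := by
    refine intervalIntegral.tendsto_integral_filter_of_dominated_convergence (fun _ => B)
      (Eventually.of_forall fun n => ?_) (Eventually.of_forall fun n => ae_of_all _ fun s hs => ?_)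
      intervalIntegrable_const (ae_of_all _ fun s hs => ?_)
    · rw [uIoc_of_le hT.le]
      exact ((hJ n).mono Ioc_subset_Icc_self).aestronglyMeasurable measurableSet_Ioc
    · rw [uIoc_of_le hT.le] at hs
      exact hB n s (Ioc_subset_Icc_self hs)
    · rw [uIoc_of_le hT.le] at hs
      exact hlim s hs
  have h2 : ∫ s in (0 : ℝ)..T, j s = 0 := tendsto_nhds_unique h1 hint
  have hjB : ∀ s ∈ Ioc 0 T, ‖j s‖ ≤ B := fun s hs =>
    le_of_tendsto (hlim s hs).abs (Eventually.of_forall fun n => hB n s (Ioc_subset_Icc_self hs))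
  have hji : IntegrableOn j (Ioc 0 T) :=
    IntegrableOn.of_bound measure_Ioc_lt_top (hj.aestronglyMeasurable measurableSet_Ioc) B
      ((ae_restrict_iff' measurableSet_Ioc).2 (ae_of_all _ hjB))
  rw [intervalIntegral.integral_of_le hT.le, setIntegral_eq_zero_iff_of_nonneg_ae
    ((ae_restrict_iff' measurableSet_Ioc).2 (ae_of_all _ hj0)) hji] at h2
  -- The zero integral gives `j = 0` only for almost every time; continuity of `j` gives it for all.
  exact Measure.eqOn_Ioc_of_ae_eq _ h2 hj continuousOn_const

/-- Every limit of the solutions as `ε → 0` is concentrated on the isoperimetric line. -/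
theorem ae_eq_sphereArea_of_tendsto {α β μ σ : ℝ} {K : Quadrant → Quadrant → ℝ}
    (hK : IsCoagulationKernel α β K) {r : ℝ → ℝ → ℝ} (hr : IsFusionKernel μ σ r)
    {m₀ : RadonMeasure Quadrant} {T C : ℝ} (hT : 0 < T) (hC : 0 ≤ C) {u : ℕ → ℝ}
    (hu : ∀ n, u n ∈ Ioo (0 : ℝ) 1) (hu0 : Tendsto u atTop (𝓝 0))
    {f : ℕ → ℝ → RadonMeasure Quadrant} (hf : ∀ n, IsFusionSolution α β K r (u n) m₀ (f n))
    (hmom : ∀ n, ∀ t ∈ Icc 0 T, HasMomentBound μ σ C (f n t).1)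
    {g : ℝ → RadonMeasure Quadrant} (hg : ∀ t ∈ Ioc 0 T, g t ∈ isoperimetricMeasures)
    (hgc : ContinuousOn g (Ioc 0 T))
    (hlim : ∀ t ∈ Ioc 0 T, Tendsto (fun n => f n t) atTop (𝓝 (g t))) :
    ∀ t ∈ Ioc 0 T, ∀ᵐ η ∂(g t).1, (η.1 : ℝ) = sphereArea η.2 := by
  intro t ht
  have hnull : (g t).1 {η : Quadrant | sphereArea η.2 < η.1} = 0 := by
    -- The quadrant is second countable, so it suffices to find a null neighbourhood of each point
    -- off the line.
    refine measure_null_of_locally_null _ fun η₀ hη₀ => ?_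
    obtain ⟨ψ, hψ0, hψη, hψ⟩ := exists_localized_flux hK hr m₀ hT hC η₀ hη₀
    obtain ⟨Ψ, hΨ⟩ := ψ.hasCompactSupport.exists_bound_of_continuous ψ.continuous
    have hΨ0 : 0 ≤ Ψ := (norm_nonneg _).trans (hΨ η₀)
    have hpos : ∀ m ∈ isoperimetricMeasures, 0 ≤ᵐ[m.1] fun η => ψ η := fun m hm => by
      filter_upwards [ae_sphereArea_le hm] with η hη
      exact hψ0 η hη
    have hzero : EqOn (fun s => ∫ η, ψ η ∂(g s).1) 0 (Ioc 0 T) := by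
      refine eqOn_zero_of_tendsto_integral (B := Ψ * C) hT
        (J := fun n s => ∫ η, ψ η ∂(f n s).1)
        (fun n => ((hf n).continuousOn_integral ψ).mono Icc_subset_Ici_self)
        (fun n s hs => ?_) (fun s hs => tendsto_radonMeasure_iff.1 (hlim s hs) ψ)
        (continuousOn_radonMeasure_iff.1 hgc ψ)
        (fun s hs => integral_nonneg_of_ae (hpos _ (hg s hs))) ?_
      · exact (hmom n s hs).abs_integral_le hC hΨ0 (ae_of_all _ fun η =>
          (hΨ η).trans (le_mul_of_one_le_right hΨ0 (one_le_momentWeight μ σ η)))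
      · rw [Metric.tendsto_atTop']
        intro δ hδ
        obtain ⟨E, hE⟩ := hψ (δ / 2) (half_pos hδ)
        have hu' : Tendsto (fun n => δ / 2 + u n * E) atTop (𝓝 (δ / 2)) := by
          simpa using tendsto_const_nhds.add (hu0.mul_const E)
        obtain ⟨k, hk⟩ := (hu'.eventually (gt_mem_nhds (half_lt_self hδ))).exists_forall_of_atTop
        refine ⟨k, fun n hn => ?_⟩
        rw [dist_zero_right]
        exact (hE (u n) (hu n) (f n) (hf n) (hmom n)).trans_lt (hk n hn.le)
    have := (g t).2
    have hψi : Integrable (fun η => ψ η) (g t).1 :=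
      ψ.continuous.integrable_of_hasCompactSupport ψ.hasCompactSupport
    have hae := (integral_eq_zero_iff_of_nonneg_ae (hpos _ (hg t ht)) hψi).1 (hzero ht)
    -- A function that is nonnegative almost everywhere and has zero integral vanishes almost
    -- everywhere, so its open non-vanishing set is the required null neighbourhood.
    refine ⟨{η | ψ η ≠ 0}, mem_nhdsWithin_of_mem_nhds
      ((isOpen_ne_fun ψ.continuous continuous_const).mem_nhds hψη), ?_⟩
    exact ae_iff.1 hae
  filter_upwards [ae_sphereArea_le (hg t ht), measure_eq_zero_iff_ae_notMem.1 hnull] with η h1 h2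
  exact le_antisymm (not_lt.1 h2) h1

end FastFusion

/-! ### The density as the volume marginal of the limit -/

theorem lemma1p7
    (α β μ σ : ℝ)
    (K : FastFusion.Quadrant → FastFusion.Quadrant → ℝ)
    (hK : FastFusion.IsCoagulationKernel α β K)
    (r : ℝ → ℝ → ℝ) (hr : FastFusion.IsFusionKernel μ σ r)
    (fin : FastFusion.RadonMeasure FastFusion.Quadrant)
    (hfin : fin ∈ FastFusion.isoperimetricMeasures)
    (T : ℝ) (hT : 0 < T)
    -- the solutions `f ε`, `ε ∈ (0, 1)`, with moments bounded uniformly in `ε`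
    (f : ℝ → ℝ → FastFusion.RadonMeasure FastFusion.Quadrant)
    (hf : ∀ ε ∈ Ioo (0 : ℝ) 1, FastFusion.IsFusionSolution α β K r ε fin (f ε))
    (hmom : ∃ C : ℝ, ∀ ε ∈ Ioo (0 : ℝ) 1, ∀ t ∈ Icc 0 T,
      ∫⁻ η, ENNReal.ofReal (FastFusion.momentWeight μ σ η) ∂(f ε t).1 ≤ ENNReal.ofReal C)
    -- the limit `fbar` along a sequence `u n → 0` of values of `ε`
    (fbar : ℝ → FastFusion.RadonMeasure FastFusion.Quadrant)
    (hfbar_mem : ∀ t ∈ Ioc 0 T, fbar t ∈ FastFusion.isoperimetricMeasures)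
    (hfbar_cont : ContinuousOn fbar (Ioc 0 T))
    (u : ℕ → ℝ) (hu : ∀ n, u n ∈ Ioo (0 : ℝ) 1) (hu0 : Tendsto u atTop (𝓝 0))
    (hlim : ∀ t ∈ Ioc 0 T, Tendsto (fun n => f (u n) t) atTop (𝓝 (fbar t))) :
    ∃ F : ℝ → FastFusion.RadonMeasure FastFusion.PosReal,
      ContinuousOn F (Ioc 0 T) ∧
      (∀ φ : C₀(FastFusion.PosReal, ℝ),
        ContinuousOn (fun t => ∫ v, φ v ∂(F t).1) (Ioc 0 T)) ∧
      ∀ t ∈ Ioc 0 T,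
        IsFiniteMeasure (F t).1 ∧
        (fbar t).1 = (F t).1.map FastFusion.isoPoint ∧
        ∀ φ : C₀(FastFusion.Quadrant, ℝ),
          Integrable (fun η => φ η) (fbar t).1 ∧
          Integrable (fun v => φ (FastFusion.isoPoint v)) (F t).1 ∧
          ∫ η, φ η ∂(fbar t).1 = ∫ v, φ (FastFusion.isoPoint v) ∂(F t).1 := by
  open FastFusion in
  obtain ⟨C', hC'⟩ := hmom
  obtain ⟨C, hC, hmom⟩ : ∃ C : ℝ, 0 ≤ C ∧ ∀ n, ∀ t ∈ Icc 0 T,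
      HasMomentBound μ σ C (f (u n) t).1 :=
    ⟨max C' 0, le_max_right _ _, fun n t ht =>
      (hC' (u n) (hu n) t ht).trans (ENNReal.ofReal_le_ofReal (le_max_left _ _))⟩
  have hline := ae_eq_sphereArea_of_tendsto hK hr hT hC hu hu0 (fun n => hf (u n) (hu n)) hmom
    hfbar_mem hfbar_cont hlim
  have hmass : ∀ t ∈ Ioc 0 T, (fbar t).1 univ ≤ ENNReal.ofReal C := fun t ht =>
    have := (fbar t).2
    measure_univ_le_of_tendsto (tendsto_radonMeasure_iff.1 (hlim t ht)) hC fun n =>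
      (hmom n t (Ioc_subset_Icc_self ht)).measure_univ_le
  classical
  -- Projecting an infinite Radon measure need not give a Radon measure, and finite mass of `fbar t`
  -- is known only for `t` in `(0, T]`; hence the value `0` at other times.
  let ν : ℝ → Measure PosReal := fun t =>
    if t ∈ Ioc 0 T then (fbar t).1.map Prod.snd else 0
  have hν : ∀ t ∈ Ioc 0 T, ν t = (fbar t).1.map Prod.snd := fun t ht => if_pos ht
  have hνmass : ∀ t ∈ Ioc 0 T, ν t univ ≤ ENNReal.ofReal C := fun t ht => by
    rw [hν t ht, Measure.map_apply measurable_snd MeasurableSet.univ]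
    exact hmass t ht
  have hνfin : ∀ t, IsFiniteMeasure (ν t) := fun t => by
    by_cases ht : t ∈ Ioc 0 T
    · exact ⟨(hνmass t ht).trans_lt ENNReal.ofReal_lt_top⟩
    · rw [show ν t = 0 from if_neg ht]
      infer_instance
  have hcont : ∀ φ : PosReal → ℝ, Continuous φ → HasCompactSupport φ →
      ContinuousOn (fun t => ∫ v, φ v ∂ν t) (Ioc 0 T) := fun φ hφ hφc =>
    (continuousOn_integral_snd (ν := fun t => (fbar t).1)
      (continuousOn_radonMeasure_iff.1 hfbar_cont) hline hφ hφc).congr fun t ht => by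
        beta_reduce
        rw [hν t ht, integral_map measurable_snd.aemeasurable hφ.aestronglyMeasurable]
  refine ⟨fun t => ⟨ν t, inferInstance⟩,
    continuousOn_radonMeasure_iff.2 fun φ => hcont φ φ.continuous φ.hasCompactSupport,
    continuousOn_integral_zeroAtInfty hC hνmass hcont, fun t ht => ⟨hνfin t, ?_⟩⟩
  have hmap : (fbar t).1 = (ν t).map isoPoint := by
    rw [hν t ht, Measure.map_map continuous_isoPoint.measurable measurable_snd]
    have h : isoPoint ∘ Prod.snd =ᵐ[(fbar t).1] id := by
      filter_upwards [hline t ht] with η hη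
      exact Prod.ext (Subtype.ext hη.symm) rfl
    rw [Measure.map_congr h, Measure.map_id]
  refine ⟨hmap, fun φ => ?_⟩
  have hint : ∀ {X : Type} [TopologicalSpace X] [MeasurableSpace X] [OpensMeasurableSpace X]
      (m : Measure X) [IsFiniteMeasure m] (g : X → Quadrant), Continuous g →
      Integrable (fun x => φ (g x)) m := fun m _ g hg =>
    Integrable.of_bound (φ.continuous.comp hg).aestronglyMeasurable ‖φ.toBCF‖
      (ae_of_all _ fun x => φ.toBCF.norm_coe_le_norm (g x))
  have : IsFiniteMeasure (fbar t).1 := ⟨(hmass t ht).trans_lt ENNReal.ofReal_lt_top⟩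
  refine ⟨hint _ id continuous_id, hint (ν t) isoPoint continuous_isoPoint, ?_⟩
  change ∫ η, φ η ∂(fbar t).1 = ∫ v, φ (isoPoint v) ∂ν t
  rw [hmap]
  exact integral_map continuous_isoPoint.measurable.aemeasurable
    (map_continuous φ).aestronglyMeasurable
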